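/- All groups and sets are finite. For a finite set $X$, $L(X)$ is the space of functions $X\to\mathbb C$ with $\langle f_1,f_2\rangle=\sum_{x}f_1(x)\overline{f_2(x)}$; for a group acting on $X$ put $(gf)(x)=f(g^{-1}x)$. Identify $L(X)\otimes L(Y)$ with $L(X\times Y)$ by $(f\otimes h)(x,y)=f(x)h(y)$. Let $G$ act transitively on $X$ and $F$ act transitively on $Y$; let $x_0\in X$, $y_0\in Y$ have stabilizers $K\le G$ and $H\le F$. Let $\mathcal P$ be a $G$-invariant partition of $X$ and $\mathcal Q$ an $F$-invariant partition of $Y$. Let $N=\{u\in F: uB=B\text{ for all }B\in\mathcal Q\}$, and assume that $N$ is transitive on every part $B\in\mathcal Q$. Let $A_0\in\mathcal P$ be the part containing $x_0$ and $T=\{g\in G:gA_0=A_0\}$. In the wreath product $F\wr G=F^X\rtimes G$, where $(f,g)(f',g')=(f\cdot gf',gg')$ with $(gf')(x)=f'(g^{-1}x)$, let $N^{\mathcal P}$ be the group of all functions $X\to N$ that are constant on each part of $\mathcal P$ and $F^{\rm diag}$ the group of all constant functions $X\to F$. The crested product is the subgroup $C=(N^{\mathcal P}\cdot F^{\rm diag})\rtimes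 G$. It acts on $X\times Y$ by $(f,g)(x,y)=(gx,f(gx)y)$. Let $R\le C$ be the stabilizer of $(x_0,y_0)$. Let $$L(X)=\bigoplus_{\omega\in\Omega}a_\omega V_\omega,\qquad L(Y)=\bigoplus_{\delta\in\Delta}b_\delta W_\delta,\qquad L(A_0)=\bigoplus_{\gamma\in\Gamma}c_\gamma U_\gamma$$ be the isotypic decompositions for $G$, $F$ and $T$ respectively: the $V_\omega$ are irreducible, pairwise inequivalent, with multiplicities $a_\omega\geq 1$, and similarly for $W_\delta$, $b_\delta$ and $U_\gamma$, $c_\gamma$. Below, $V_\omega\subseteq L(X)$, $W_\delta\subseteq L(Y)$ and $U_\gamma\subseteq L(A_0)$ may be any of the copies in these decompositions. Let $\Delta_0$ be the set of all $\delta\in\Delta$ whose component $b_\delta W_\delta$ consists of functions constant on the parts of $\mathcal Q$. For a function $u$ on $A_0$ let $\tilde u$ be its extension by zero to $X$. Let $\mathrm{Ind}_T^GU_\gamma\subseteq L(X)$ be the span of the functions $g\tilde u$ with $g\in G$, $u\in U_\gamma$. The spaces $V_\omega\otimes W_\delta$ and $(\mathrm{Ind}_T^GU_\gamma)\otimes W_\delta$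 are regarded as subspaces of $L(X\times Y)$. For a group acting transitively on a set with base point $z_0$ and a finite family $e_1,\dots,e_m$ of functions invariant under the stabilizer of $z_0$, the corresponding spherical matrix coefficients are the functions $gz_0\mapsto\langle e_i,g\,e_{i'}\rangle$ on that set. Let $v^\omega_1,\dots,v^\omega_{a_\omega}$, $w^\delta_1,\dots,w^\delta_{b_\delta}$ and $u^\gamma_1,\dots,u^\gamma_{c_\gamma}$ be orthonormal bases of the $K$-invariant vectors of $V_\omega$, the $H$-invariant vectors of $W_\delta$ and the $K$-invariant vectors of $U_\gamma$. Let $\phi^\omega_{i,i'}$ (on $X$), $\psi^\delta_{j,j'}$ (on $Y$) and $\theta^\gamma_{h,h'}$ (on $A_0$) be the corresponding spherical matrix coefficients, for $G$, $F$ and $T$ respectively, and let $\tilde\theta^\gamma_{h,h'}$ be the extension of $\theta^\gamma_{h,h'}$ by zero to $X$. **Theorem.** 1. For $\omega\in\Omega$ and $\delta\in\Delta_0$, the space $V_\omega\otimes W_\delta$ is an irreducible representation of $C$, and the vectors $v_i^\omega\otimes w_j^\delta$ ($1\le i\le a_\omega$, $1\le j\le b_\delta$) form an orthonormal basis of its $R$-invariant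 vectors. The corresponding spherical matrix coefficients are the functions $(x,y)\mapsto\phi^\omega_{i,i'}(x)\,\psi^\delta_{j,j'}(y)$ on $X\times Y$. 2. For $\gamma\in\Gamma$ and $\delta\in\Delta\setminus\Delta_0$, the space $(\mathrm{Ind}_T^GU_\gamma)\otimes W_\delta$ is an irreducible representation of $C$, and the vectors $\tilde u_h^\gamma\otimes w_j^\delta$ ($1\le h\le c_\gamma$, $1\le j\le b_\delta$) form an orthonormal basis of its $R$-invariant vectors. The corresponding spherical matrix coefficients are the functions $(x,y)\mapsto\tilde\theta^\gamma_{h,h'}(x)\,\psi^\delta_{j,j'}(y)$ on $X\times Y$. -/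

import Mathlib

open scoped Pointwise

noncomputable section

/-- `L(X)`: complex functions on a finite set, with the unnormalised scalar product
`∑ x, f₁ x * conj (f₂ x)` (which is `inner ℂ f₂ f₁`, Mathlib's inner product being
linear in its second argument). -/
abbrev FunSpace (X : Type*) := EuclideanSpace ℂ X

/-- The permutation representation of `G` on `L(X)`: `(g f)(x) = f (g⁻¹ x)`. -/
def permRep (G X : Type*) [Group G] [MulAction G X] : Representation ℂ G (FunSpace X) where
  toFun g :=
    { toFun := fun f => WithLp.toLp 2 fun x => f (g⁻¹ • x)
      map_add' := fun _ _ => rfl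
      map_smul' := fun _ _ => rfl }
  map_one' := by ext f x; simp
  map_mul' g h := by
    ext f x
    change f ((g * h)⁻¹ • x) = f (h⁻¹ • g⁻¹ • x)
    rw [mul_inv_rev, mul_smul]

/-- `M` is (the space of) an irreducible subrepresentation of `ρ`. -/
def IsIrreducibleSub {G E : Type*} [Group G] [AddCommGroup E] [Module ℂ E]
    (ρ : Representation ℂ G E) (M : Submodule ℂ E) : Prop :=
  ∃ S : Subrepresentation ρ, S.toSubmodule = M ∧ S.toRepresentation.IsIrreducible

/-- `E = ⨁ ω, m ω • V ω` is the isotypic decomposition of the representation `ρ` on `E`: `E` is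
the direct sum of the irreducible subrepresentations `V ω k`, `k = 0, …, m ω - 1`, and
`V ω k`, `V ω' k'` are equivalent exactly when `ω = ω'`. -/
structure IsIsotypicDecomposition {G E : Type*} [Group G] [AddCommGroup E] [Module ℂ E]
    (ρ : Representation ℂ G E) {Ω : Type*} (m : Ω → ℕ)
    (V : (ω : Ω) → Fin (m ω) → Subrepresentation ρ) : Prop where
  mult_pos : ∀ ω, 0 < m ω
  irreducible : ∀ ω k, (V ω k).toRepresentation.IsIrreducible
  equiv_iff : ∀ ω k ω' k',
    Nonempty ((V ω k).toRepresentation.Equiv (V ω' k').toRepresentation) ↔ ω = ω'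
  independent : iSupIndep fun p : (Σ ω, Fin (m ω)) => (V p.1 p.2).toSubmodule
  iSup_eq_top : ⨆ p : (Σ ω, Fin (m ω)), (V p.1 p.2).toSubmodule = ⊤

/-- The family `e` is an orthonormal basis of the space of those vectors of `M ⊆ L(X)` which are
invariant under the stabilizer of `x₀` in `G`. -/
def IsInvariantONB (G : Type*) {X : Type*} [Group G] [MulAction G X] [Fintype X] (x₀ : X)
    (M : Submodule ℂ (FunSpace X)) {ι : Type*} (e : ι → FunSpace X) : Prop :=
  Orthonormal ℂ e ∧
    ∀ f, f ∈ Submodule.span ℂ (Set.range e) ↔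
      f ∈ M ∧ ∀ k ∈ MulAction.stabilizer G x₀, permRep G X k f = f

/-- The functions `Φ i j` on `X` are the spherical matrix coefficients of the family `e` in
`L(X)`: `Φ i j (g x₀) = ⟨e i, g (e j)⟩`, the scalar product being linear in its first argument. -/
def IsSphericalCoeffs (G : Type*) {X : Type*} [Group G] [MulAction G X] [Fintype X] (x₀ : X)
    {ι : Type*} (e : ι → FunSpace X) (Φ : ι → ι → X → ℂ) : Prop :=
  ∀ i j (g : G), Φ i j (g • x₀) = inner ℂ (permRep G X g (e j)) (e i)

/-- A `G`-invariant partition of `X`, given by its equivalence relation. -/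
structure InvariantPartition (G X : Type*) [Group G] [MulAction G X] extends Setoid X where
  smul_rel : ∀ (g : G) {x x' : X}, r x x' → r (g • x) (g • x')

namespace InvariantPartition

variable {G X : Type*} [Group G] [MulAction G X] (P : InvariantPartition G X)

/-- The part of the partition which contains `x`. -/
def block (x : X) : Set X := {x' | P.r x' x}

instance fintypeBlock [Finite X] (x : X) : Fintype (P.block x) := Fintype.ofFinite _

/-- The point `x`, as a point of its part. -/
def basePoint (x : X) : P.block x := ⟨x, P.iseqv.refl x⟩

theorem smul_block (g : G) (x : X) : g • P.block x = P.block (g • x) := by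
  ext z
  rw [Set.mem_smul_set_iff_inv_smul_mem]
  refine ⟨fun h => ?_, fun h => ?_⟩
  · have := P.smul_rel g h
    rwa [smul_inv_smul] at this
  · have := P.smul_rel g⁻¹ h
    rwa [inv_smul_smul] at this

/-- The subgroup of all elements of `G` which map every part onto itself. -/
def kernel : Subgroup G := ⨅ x, MulAction.stabilizer G (P.block x)

theorem mem_kernel {g : G} : g ∈ P.kernel ↔ ∀ x, g • P.block x = P.block x := by
  simp [kernel, Subgroup.mem_iInf]

theorem conj_mem_kernel {n : G} (hn : n ∈ P.kernel) (g : G) : g * n * g⁻¹ ∈ P.kernel := by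
  rw [mem_kernel] at hn ⊢
  intro x
  rw [mul_smul, mul_smul, smul_block P g⁻¹ x, hn, smul_block, smul_inv_smul]

/-- The setwise stabilizer in `G` of the part of `x`; it acts on this part. -/
abbrev blockStabilizer (x : X) : Subgroup G := MulAction.stabilizer G (P.block x)

/-- The space of those functions on `X` which are constant on every part. -/
def constFun : Submodule ℂ (FunSpace X) where
  carrier := {f | ∀ x x', P.r x x' → f x = f x'}
  zero_mem' := fun _ _ _ => rfl
  add_mem' := fun hf hg x x' h => by simp [hf x x' h, hg x x' h]
  smul_mem' := fun c f hf x x' h => by simp [hf x x' h]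

/-- For an isotypic decomposition of `L(X)`, the set of those indices whose isotypic component
consists of functions that are constant on every part. -/
def constIndices {Δ : Type*} {m : Δ → ℕ}
    (W : (δ : Δ) → Fin (m δ) → Subrepresentation (permRep G X)) : Set Δ :=
  {δ | ⨆ l, (W δ l).toSubmodule ≤ P.constFun}

/-- Extension by zero of a function on the part of `x` to a function on `X`. -/
def extendZero (x : X) (u : FunSpace (P.block x)) : FunSpace X :=
  WithLp.toLp 2 (Function.extend Subtype.val u 0)

/-- For a space `U` of functions on the part of `x`, invariant under the stabilizer `T` of this
part, the representation of `G` induced by `U`, realized in `L(X)`: the span of the `G`-translates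
of the functions of `U` extended by zero. It is the direct sum of the translates `l U`, where `l`
runs over representatives of the left cosets of `T`. -/
def induced (x : X) (U : Submodule ℂ (FunSpace (P.block x))) : Submodule ℂ (FunSpace X) :=
  Submodule.span ℂ {f | ∃ g : G, ∃ u ∈ U, f = permRep G X g (P.extendZero x u)}

end InvariantPartition

/-- The wreath product `F ≀ G = F^X ⋊ G`, where `(g f)(x) = f (g⁻¹ x)`. -/
abbrev WreathProd (F G X : Type*) [Group F] [Group G] [MulAction G X] :=
  (X → F) ⋊[(mulAutArrow : G →* MulAut (X → F))] G

/-- The composition action of `F ≀ G` on `X × Y`: `(f, g) (x, y) = (g x, f (g x) y)`. -/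
instance compositionAction {F G X Y : Type*} [Group F] [Group G] [MulAction G X] [MulAction F Y] :
    MulAction (WreathProd F G X) (X × Y) where
  smul c z := (c.right • z.1, c.left (c.right • z.1) • z.2)
  one_smul z := by
    change ((1 : G) • z.1, (1 : F) • z.2) = z
    simp
  mul_smul c d z := by
    change ((c.right * d.right) • z.1,
        (c.left ((c.right * d.right) • z.1) *
          d.left (c.right⁻¹ • (c.right * d.right) • z.1)) • z.2) =
      (c.right • d.right • z.1,
        c.left (c.right • d.right • z.1) • d.left (d.right • z.1) • z.2)
    simp [mul_smul]

/-- The crested product of `F` by `G`: the subgroup `(N^P · F^diag) ⋊ G` of `F ≀ G`, where `N` is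
the subgroup of `F` stabilizing every part of `Q`, `N^P` is the group of functions `X → N` that
are constant on the parts of `P`, and `F^diag` is the group of constant functions `X → F`. -/
def crestedProduct {F G X Y : Type*} [Group F] [Group G] [MulAction G X] [MulAction F Y]
    (P : InvariantPartition G X) (Q : InvariantPartition F Y) : Subgroup (WreathProd F G X) where
  carrier := {c | ∃ n : X → F, (∀ x, n x ∈ Q.kernel) ∧ (∀ x x', P.r x x' → n x = n x') ∧
    ∃ u : F, ∀ x, c.left x = n x * u}
  one_mem' := ⟨1, fun _ => Q.kernel.one_mem, fun _ _ _ => rfl, 1, fun _ => by simp⟩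
  mul_mem' := by
    rintro c d ⟨n, hn, hnP, u, hu⟩ ⟨m, hm, hmP, v, hv⟩
    refine ⟨fun x => n x * (u * m (c.right⁻¹ • x) * u⁻¹),
      fun x => Q.kernel.mul_mem (hn x) (Q.conj_mem_kernel (hm _) u), fun x x' h => ?_, u * v,
      fun x => ?_⟩
    · simp only [hnP x x' h, hmP _ _ (P.smul_rel c.right⁻¹ h)]
    · change c.left x * d.left (c.right⁻¹ • x) = _
      rw [hu, hv]
      group
  inv_mem' := by
    rintro c ⟨n, hn, hnP, u, hu⟩
    refine ⟨fun x => u⁻¹ * (n (c.right • x))⁻¹ * u,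
      fun x => ?_, fun x x' h => ?_, u⁻¹, fun x => ?_⟩
    · simpa using Q.conj_mem_kernel (Q.kernel.inv_mem (hn (c.right • x))) u⁻¹
    · simp only [hnP _ _ (P.smul_rel c.right h)]
    · change (c.left (c.right⁻¹⁻¹ • x))⁻¹ = _
      rw [inv_inv, hu]
      group

/-- `(f ⊗ h)(x, y) = f x * h y`. -/
def tensorFun {X Y : Type*} (f : FunSpace X) (h : FunSpace Y) : FunSpace (X × Y) :=
  WithLp.toLp 2 fun z => f z.1 * h z.2

/-- The tensor product `V ⊗ W ⊆ L(X) ⊗ L(Y) = L(X × Y)`. -/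
def tensorSub {X Y : Type*} (V : Submodule ℂ (FunSpace X)) (W : Submodule ℂ (FunSpace Y)) :
    Submodule ℂ (FunSpace (X × Y)) :=
  Submodule.span ℂ {f | ∃ v ∈ V, ∃ w ∈ W, f = tensorFun v w}

end

/-! ### Rank-one operators inside the group algebra of an irreducible representation. -/

section Density

/-! Everything rests on how an element `(f, g)` of the crested product acts on a pure tensor `v ⊗
w`. It acts as `g v ⊗ f(g x₀) w` in two situations: when `w` is constant on the parts of `Q`, since
the `N`-component of `f` then does nothing, and when `v` is supported on the part of `x₀`, since `f`
is constant on parts of `P`. These are `actsThrough_of_const` and `actsThrough_of_support`, and they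
govern statements 1 and 2.

The copy of `G` moves only the first factor and the constant functions move only the second. By
Schur and Jacobson density, every rank-one operator on an irreducible `V` lies in the image of the
group algebra, so any nonzero element of `V ⊗ W` in an invariant subspace produces a nonzero pure
tensor there, and then all of `V ⊗ W`. This settles statement 1.

In statement 2, irreducibility and transitivity of `N` on the parts of `Q` make the sum over `N`
vanish on `W` (`sum_kernel_eq_zero`). Averaging over the copy of `N` acting on a single part of `P`
therefore kills that part and fixes the others; subtracting the average from the identity gives
restriction to the part, as an element of the group algebra (`blockRestrict_eq`). An invariant
subspace thus contains a nonzero vector of `Ũ ⊗ W`, where `Ũ` is `U` extended by zero; the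
stabilizer of the part and the diagonal fill this space, and `G` translates it to the whole induced
space. The same averages show that `R`-invariant vectors live over the part of `x₀`.

Invariant vectors are then found by averaging over `K × H`, and the spherical coefficients factor
because inner products of pure tensors do. -/

open scoped MonoidAlgebra in
theorem Representation.IsIrreducible.exists_asAlgebraHom_eq {G V : Type*} [Group G]
    [AddCommGroup V] [Module ℂ V] [FiniteDimensional ℂ V] (ρ : Representation ℂ G V)
    [ρ.IsIrreducible] (f : Module.End ℂ V) : ∃ r : ℂ[G], ρ.asAlgebraHom r = f := by
  have hs := (IsSimpleModule.algebraMap_end_bijective_of_isAlgClosed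
    (A := ℂ[G]) (V := ρ.asModule) ℂ).2
  -- By Schur the commutant consists of scalars, so any `ℂ`-linear map is linear over it; density on
  -- a finite basis then realizes the map by one group algebra element.
  let φ : Module.End (Module.End ℂ[G] ρ.asModule) ρ.asModule :=
    { toFun := fun v => f v
      map_add' := fun v w => f.map_add v w
      map_smul' := fun a v => by
        obtain ⟨z, rfl⟩ := hs a
        exact f.map_smul z v }
  classical
  let bas := Module.finBasis ℂ V
  obtain ⟨r, hr⟩ := jacobson_density (R := ℂ[G]) (M := ρ.asModule) φ
    (Finset.univ.image bas : Finset V)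
  refine ⟨r, bas.ext fun i => ?_⟩
  exact (hr (bas i) (Finset.mem_image_of_mem _ (Finset.mem_univ _))).symm

theorem Subrepresentation.exists_sum_smul_eq {G E : Type*} [Group G]
    [AddCommGroup E] [Module ℂ E] [FiniteDimensional ℂ E] {ρ : Representation ℂ G E}
    (S : Subrepresentation ρ) (hS : S.toRepresentation.IsIrreducible)
    (ℓ : E →ₗ[ℂ] ℂ) {v' : E} (hv' : v' ∈ S.toSubmodule) :
    ∃ c : G →₀ ℂ, ∀ v ∈ S.toSubmodule, (c.sum fun g a => a • ρ g v) = ℓ v • v' := by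
  -- The operator to be realized has rank one: `v ↦ ℓ v • v'`.
  obtain ⟨r, hr⟩ := Representation.IsIrreducible.exists_asAlgebraHom_eq S.toRepresentation
    ((ℓ.comp S.toSubmodule.subtype).smulRight ⟨v', hv'⟩)
  refine ⟨r.coeff, fun v hv => ?_⟩
  have h := congrArg (fun f => S.toSubmodule.subtype (f ⟨v, hv⟩)) hr
  simp only [Representation.asAlgebraHom_def, MonoidAlgebra.lift_apply] at h
  rw [Finsupp.sum, LinearMap.sum_apply, map_sum] at h
  exact h

end Density

/-! ### Irreducibility tested on invariant subspaces of the ambient space. -/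

section Irreducible

variable {G E : Type*} [Group G] [AddCommGroup E] [Module ℂ E] {ρ : Representation ℂ G E}

theorem isIrreducibleSub_of_forall_le {M : Submodule ℂ E} (hM : ∀ g, ∀ v ∈ M, ρ g v ∈ M)
    (hne : M ≠ ⊥)
    (h : ∀ S ≤ M, (∀ g, ∀ v ∈ S, ρ g v ∈ S) → S ≠ ⊥ → M ≤ S) : IsIrreducibleSub ρ M := by
  refine ⟨⟨M, hM⟩, rfl, ?_⟩
  have htop : (⊤ : Subrepresentation (Subrepresentation.toRepresentation ⟨M, hM⟩)) ≠ ⊥ := by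
    intro h0
    refine hne ((Submodule.eq_bot_iff _).2 fun v hv => ?_)
    have : (⟨v, hv⟩ : M) ∈ (⊤ : Subrepresentation
      (Subrepresentation.toRepresentation (ρ := ρ) ⟨M, hM⟩)).toSubmodule := Submodule.mem_top
    rw [h0] at this
    exact congrArg Subtype.val ((Submodule.mem_bot ℂ).1 this)
  refine { exists_pair_ne := ⟨⊤, ⊥, htop⟩, eq_bot_or_eq_top := fun S => ?_ }
  rw [or_iff_not_imp_left]
  intro hS
  have hle := h (S.toSubmodule.map M.subtype) (Submodule.map_subtype_le _ _) ?_ ?_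
  · refine Subrepresentation.toSubmodule_injective (eq_top_iff.2 fun v _ => ?_)
    obtain ⟨w, hw, hwv⟩ := hle v.2
    rwa [← Subtype.ext (a1 := w) (a2 := v) hwv]
  · rintro g _ ⟨v, hv, rfl⟩
    exact ⟨_, S.apply_mem_toSubmodule g hv, rfl⟩
  · intro h0
    refine hS (Subrepresentation.toSubmodule_injective ((Submodule.eq_bot_iff _).2 fun v hv => ?_))
    have : M.subtype v ∈ S.toSubmodule.map M.subtype := ⟨v, hv, rfl⟩
    rw [h0] at this
    exact Subtype.ext ((Submodule.mem_bot ℂ).1 this)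

namespace Subrepresentation

theorem exists_ne_zero (S : Subrepresentation ρ) (hS : S.toRepresentation.IsIrreducible) :
    ∃ v ∈ S.toSubmodule, v ≠ 0 := by
  by_contra! h
  refine (bot_ne_top (α := Subrepresentation S.toRepresentation))
    (toSubmodule_injective (Submodule.ext fun v => ?_))
  rw [Subtype.ext (h v v.2) (a2 := (0 : S.toSubmodule))]
  exact ⟨fun _ => Submodule.zero_mem _, fun _ => Submodule.zero_mem _⟩

theorem le_of_irreducible (S : Subrepresentation ρ) (hS : S.toRepresentation.IsIrreducible)
    {M : Submodule ℂ E} (hM : ∀ g, ∀ v ∈ M, ρ g v ∈ M) {v : E} (hv : v ∈ S.toSubmodule)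
    (hvM : v ∈ M) (h0 : v ≠ 0) : S.toSubmodule ≤ M := by
  let M' : Subrepresentation S.toRepresentation :=
    ⟨M.comap S.toSubmodule.subtype, fun g w hw => hM g w hw⟩
  rcases hS.eq_bot_or_eq_top M' with h | h
  · have : (⟨v, hv⟩ : S.toSubmodule) ∈ M'.toSubmodule := hvM
    rw [h] at this
    exact absurd (congrArg Subtype.val ((Submodule.mem_bot ℂ).1 this)) h0
  · intro w hw
    have : (⟨w, hw⟩ : S.toSubmodule) ∈ M'.toSubmodule := by rw [h]; exact Submodule.mem_top
    exact this

end Subrepresentation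

end Irreducible

/-! ### Tensor products of function spaces. -/

section Tensor

variable {X Y : Type*}

@[simp]
theorem permRep_apply {G : Type*} [Group G] [MulAction G X] (g : G) (f : FunSpace X) (x : X) :
    permRep G X g f x = f (g⁻¹ • x) := rfl

@[simp]
theorem tensorFun_apply (f : FunSpace X) (h : FunSpace Y) (x : X) (y : Y) :
    tensorFun f h (x, y) = f x * h y := rfl

variable (X Y) in
/-- The bilinear map `(f, h) ↦ f ⊗ h`. -/
noncomputable def tensorBilin : FunSpace X →ₗ[ℂ] FunSpace Y →ₗ[ℂ] FunSpace (X × Y) :=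
  LinearMap.mk₂ ℂ tensorFun
    (fun f f' h => by ext z; exact add_mul _ _ _)
    (fun a f h => by ext z; exact mul_assoc _ _ _)
    (fun f h h' => by ext z; exact mul_add _ _ _)
    (fun a f h => by ext z; exact mul_left_comm _ _ _)

theorem tensorBilin_apply (f : FunSpace X) (h : FunSpace Y) :
    tensorBilin X Y f h = tensorFun f h := rfl

theorem tensorSub_eq_map₂ (V : Submodule ℂ (FunSpace X)) (W : Submodule ℂ (FunSpace Y)) :
    tensorSub V W = Submodule.map₂ (tensorBilin X Y) V W := by
  rw [Submodule.map₂_eq_span_image2, tensorSub]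
  congr 1
  ext f
  simp [Set.image2, tensorBilin_apply, eq_comm]

theorem tensorFun_mem {V : Submodule ℂ (FunSpace X)} {W : Submodule ℂ (FunSpace Y)}
    {v : FunSpace X} {w : FunSpace Y} (hv : v ∈ V) (hw : w ∈ W) :
    tensorFun v w ∈ tensorSub V W :=
  Submodule.subset_span ⟨v, hv, w, hw, rfl⟩

theorem span_range_tensorFun {ι κ : Type*} (v : ι → FunSpace X) (w : κ → FunSpace Y) :
    Submodule.span ℂ (Set.range fun p : ι × κ => tensorFun (v p.1) (w p.2)) =
      tensorSub (Submodule.span ℂ (Set.range v)) (Submodule.span ℂ (Set.range w)) := by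
  rw [tensorSub_eq_map₂, Submodule.map₂_span_span]
  congr 1
  ext f
  simp [tensorBilin_apply]

theorem inner_tensorFun [Fintype X] [Fintype Y] (v v' : FunSpace X) (w w' : FunSpace Y) :
    inner ℂ (tensorFun v w) (tensorFun v' w') = inner ℂ v v' * inner ℂ w w' := by
  simp only [PiLp.inner_apply, Fintype.sum_prod_type, Finset.sum_mul_sum, tensorFun_apply,
    RCLike.inner_apply, map_mul]
  refine Finset.sum_congr rfl fun _ _ => Finset.sum_congr rfl fun _ _ => ?_
  ring

theorem Orthonormal.tensorFun [Fintype X] [Fintype Y] {ι κ : Type*} {v : ι → FunSpace X}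
    {w : κ → FunSpace Y} (hv : Orthonormal ℂ v) (hw : Orthonormal ℂ w) :
    Orthonormal ℂ fun p : ι × κ => _root_.tensorFun (v p.1) (w p.2) := by
  classical
  rw [orthonormal_iff_ite] at hv hw ⊢
  rintro ⟨i, j⟩ ⟨i', j'⟩
  rw [inner_tensorFun, hv, hw]
  by_cases h : i = i' <;> by_cases h' : j = j' <;> simp [h, h']

/-- The function `y ↦ s (x, y)`. -/
def slice (x : X) : FunSpace (X × Y) →ₗ[ℂ] FunSpace Y where
  toFun s := WithLp.toLp 2 fun y => s (x, y)
  map_add' _ _ := rfl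
  map_smul' _ _ := rfl

@[simp]
theorem slice_apply (x : X) (s : FunSpace (X × Y)) (y : Y) : slice x s y = s (x, y) := rfl

theorem slice_mem {V : Submodule ℂ (FunSpace X)} {W : Submodule ℂ (FunSpace Y)}
    {s : FunSpace (X × Y)} (hs : s ∈ tensorSub V W) (x : X) : slice x s ∈ W := by
  refine Submodule.span_le.2 (?_ : _ ⊆ (W.comap (slice x) : Set (FunSpace (X × Y)))) hs
  rintro _ ⟨v, -, w, hw, rfl⟩
  exact W.smul_mem (v x) hw

/-- The operator `v ↦ v x₁ • v'` on the first factor turns `s` into `v' ⊗ s(x₁, ·)`. With `x₁`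
chosen so that this slice is nonzero, `hW` replaces it by any vector of `W`. -/
theorem tensorSub_le_of_mem {ι : Type*} {V : Submodule ℂ (FunSpace X)}
    {W : Submodule ℂ (FunSpace Y)} {S : Submodule ℂ (FunSpace (X × Y))}
    (A : ι → Module.End ℂ (FunSpace X)) (A' : ι → Module.End ℂ (FunSpace (X × Y)))
    (hA : ∀ i, ∀ v ∈ V, ∀ w ∈ W, A' i (tensorFun v w) = tensorFun (A i v) w)
    (hAS : ∀ i, ∀ s ∈ S, A' i s ∈ S)
    (hV : ∀ x₁, ∀ v' ∈ V, ∃ c : ι →₀ ℂ, ∀ v ∈ V, (c.sum fun i a => a • A i v) = v x₁ • v')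
    (hW : ∀ v ∈ V, ∀ w ∈ W, w ≠ 0 → tensorFun v w ∈ S → ∀ w' ∈ W, tensorFun v w' ∈ S)
    {s : FunSpace (X × Y)} (hs : s ∈ tensorSub V W) (hsS : s ∈ S) (hs0 : s ≠ 0) :
    tensorSub V W ≤ S := by
  obtain ⟨⟨x₁, y₁⟩, h1⟩ : ∃ z, s z ≠ 0 := by
    by_contra! h
    exact hs0 (by ext z; exact h z)
  refine Submodule.span_le.2 ?_
  rintro _ ⟨v', hv', w', hw', rfl⟩
  refine hW v' hv' (slice x₁ s) (slice_mem hs x₁) (fun h0 => h1 ?_) ?_ w' hw'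
  · exact congrArg (fun f : FunSpace Y => f y₁) h0
  obtain ⟨c, hc⟩ := hV x₁ v' hv'
  have key : (c.sum fun i a => a • A' i) s = tensorFun v' (slice x₁ s) := by
    let R : Module.End ℂ (FunSpace (X × Y)) := (tensorBilin X Y v').comp (slice x₁)
    refine (LinearMap.eqOn_span (R := ℂ) (f := c.sum fun i a => a • A' i) (g := R) ?_) hs
    rintro _ ⟨v, hv, w, hw, rfl⟩
    have h2 : (c.sum fun i a => a • A' i) (tensorFun v w) =
        tensorBilin X Y (c.sum fun i a => a • A i v) w := by
      simp only [Finsupp.sum, LinearMap.sum_apply, LinearMap.smul_apply, map_sum, map_smul,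
        hA _ v hv w hw, tensorBilin_apply]
    rw [h2, hc v hv]
    ext ⟨x, y⟩
    change v x₁ * v' x * w y = v' x * (v x₁ * w y)
    ring
  rw [← key, Finsupp.sum, LinearMap.sum_apply]
  exact S.sum_mem fun i _ => S.smul_mem _ (hAS i s hsS)

/-- Summing over `K × H` sends `v ⊗ w` to the tensor product of the two norms, which lies in `V₀ ⊗
W₀`, and multiplies a fixed vector by `|K| |H| ≠ 0`. -/
theorem mem_tensorSub_of_forall_fixed {K H : Type*} [Group K] [Finite K] [Group H] [Finite H]
    {V V₀ : Submodule ℂ (FunSpace X)} {W W₀ : Submodule ℂ (FunSpace Y)}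
    (ρ : Representation ℂ K (FunSpace X)) (σ : Representation ℂ H (FunSpace Y))
    (τ : K → H → Module.End ℂ (FunSpace (X × Y)))
    (hτ : ∀ k h, ∀ v ∈ V, ∀ w ∈ W, τ k h (tensorFun v w) = tensorFun (ρ k v) (σ h w))
    (hV : ∀ k, ∀ v ∈ V, ρ k v ∈ V) (hW : ∀ h, ∀ w ∈ W, σ h w ∈ W)
    (hV₀ : ∀ v ∈ V, (∀ k, ρ k v = v) → v ∈ V₀) (hW₀ : ∀ w ∈ W, (∀ h, σ h w = w) → w ∈ W₀)
    {s : FunSpace (X × Y)} (hs : s ∈ tensorSub V W) (hfix : ∀ k h, τ k h s = s) :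
    s ∈ tensorSub V₀ W₀ := by
  have := Fintype.ofFinite K
  have := Fintype.ofFinite H
  let T : Module.End ℂ (FunSpace (X × Y)) := ∑ k, ∑ h, τ k h
  have hT : T s = ((Fintype.card K : ℂ) * Fintype.card H) • s := by
    simp [T, LinearMap.sum_apply, hfix, mul_smul, ← Nat.cast_smul_eq_nsmul ℂ]
  have hmem : T s ∈ tensorSub V₀ W₀ := by
    refine Submodule.span_le.2
      (?_ : _ ⊆ ((tensorSub V₀ W₀).comap T : Set (FunSpace (X × Y)))) hs
    rintro _ ⟨v, hv, w, hw, rfl⟩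
    have h1 : T (tensorFun v w) = tensorFun (ρ.norm v) (σ.norm w) := by
      simp only [T, LinearMap.sum_apply, hτ _ _ v hv w hw, Representation.norm]
      simp only [← tensorBilin_apply, map_sum, LinearMap.sum_apply]
      exact Finset.sum_comm
    rw [SetLike.mem_coe, Submodule.mem_comap, h1]
    refine tensorFun_mem (hV₀ _ ?_ fun k => ρ.self_norm_apply k v)
      (hW₀ _ ?_ fun h => σ.self_norm_apply h w)
    · rw [Representation.norm, LinearMap.sum_apply]
      exact V.sum_mem fun k _ => hV k v hv
    · rw [Representation.norm, LinearMap.sum_apply]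
      exact W.sum_mem fun k _ => hW k w hw
  rw [hT] at hmem
  refine ((tensorSub V₀ W₀).smul_mem_iff ?_).1 hmem
  simp [Fintype.card_ne_zero]

end Tensor

/-! ### Functions constant on parts as the fixed vectors of the kernel. -/

namespace InvariantPartition

variable {G X : Type*} [Group G] [MulAction G X] (P : InvariantPartition G X)

theorem rel_smul_of_mem_kernel {n : G} (hn : n ∈ P.kernel) (x : X) : P.r (n • x) x := by
  have h : n • x ∈ n • P.block x := Set.smul_mem_smul_set (P.iseqv.refl x)
  rwa [P.mem_kernel.1 hn x] at h

theorem mem_blockStabilizer_iff (x : X) (g : G) : g ∈ P.blockStabilizer x ↔ P.r (g • x) x := by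
  rw [MulAction.mem_stabilizer_iff, smul_block]
  refine ⟨fun h => ?_, fun h => Set.ext fun z => ⟨fun hz => P.iseqv.trans hz h,
    fun hz => P.iseqv.trans hz (P.iseqv.symm h)⟩⟩
  have h1 : g • x ∈ P.block (g • x) := P.iseqv.refl _
  rwa [h] at h1

theorem permRep_eq_of_mem_constFun {f : FunSpace X} (hf : f ∈ P.constFun) {n : G}
    (hn : n ∈ P.kernel) : permRep G X n f = f := by
  ext x
  exact hf _ _ (P.rel_smul_of_mem_kernel (P.kernel.inv_mem hn) x)

theorem mem_constFun_of_forall (hP : ∀ x x', P.r x x' → ∃ n ∈ P.kernel, n • x = x')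
    {f : FunSpace X} (hf : ∀ n ∈ P.kernel, permRep G X n f = f) : f ∈ P.constFun := by
  intro x x' h
  obtain ⟨n, hn, rfl⟩ := hP x x' h
  have h1 := congrArg (fun f : FunSpace X => f (n • x)) (hf n hn)
  simpa using h1

theorem permRep_mem_constFun (g : G) {f : FunSpace X} (hf : f ∈ P.constFun) :
    permRep G X g f ∈ P.constFun :=
  fun _ _ h => hf _ _ (P.smul_rel g⁻¹ h)

/-- With the kernel transitive on each part, being constant on parts means being fixed by the
kernel, a property that equivalences preserve. Hence a single copy decides membership in
`constIndices`. -/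
theorem le_constFun_of_equiv (hP : ∀ x x', P.r x x' → ∃ n ∈ P.kernel, n • x = x')
    {S S' : Subrepresentation (permRep G X)}
    (e : S.toRepresentation.Equiv S'.toRepresentation) (h : S'.toSubmodule ≤ P.constFun) :
    S.toSubmodule ≤ P.constFun := by
  intro f hf
  refine P.mem_constFun_of_forall hP fun n hn => ?_
  have h1 : S.toRepresentation n ⟨f, hf⟩ = ⟨f, hf⟩ := by
    apply e.toLinearEquiv.injective
    have h2 : e.toLinearEquiv (S.toRepresentation n ⟨f, hf⟩) =
        S'.toRepresentation n (e.toLinearEquiv ⟨f, hf⟩) :=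
      e.toIntertwiningMap.isIntertwining _ _ n ⟨f, hf⟩
    rw [h2]
    exact Subtype.ext (P.permRep_eq_of_mem_constFun (h (e.toLinearEquiv ⟨f, hf⟩).2) hn)
  exact congrArg Subtype.val h1

theorem mem_constIndices_iff (hP : ∀ x x', P.r x x' → ∃ n ∈ P.kernel, n • x = x')
    {Δ : Type*} {m : Δ → ℕ} {W : (δ : Δ) → Fin (m δ) → Subrepresentation (permRep G X)}
    (hW : IsIsotypicDecomposition (permRep G X) m W) {δ : Δ} (l : Fin (m δ)) :
    δ ∈ P.constIndices W ↔ (W δ l).toSubmodule ≤ P.constFun := by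
  rw [constIndices, Set.mem_ofPred_eq, iSup_le_iff]
  refine ⟨fun h => h l, fun h l' => ?_⟩
  obtain ⟨e⟩ := (hW.equiv_iff δ l' δ l).2 rfl
  exact P.le_constFun_of_equiv hP e h

/-- The sum is fixed by the kernel, hence constant on parts. Were it nonzero, irreducibility of `S`
and `G`-invariance of `constFun` would force `S` into `constFun`. -/
theorem sum_kernel_eq_zero [Fintype P.kernel]
    (hP : ∀ x x', P.r x x' → ∃ n ∈ P.kernel, n • x = x')
    (S : Subrepresentation (permRep G X)) (hS : S.toRepresentation.IsIrreducible)
    (hle : ¬ S.toSubmodule ≤ P.constFun) {w : FunSpace X} (hw : w ∈ S.toSubmodule) :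
    ∑ n : P.kernel, permRep G X n w = 0 := by
  by_contra h0
  refine hle (S.le_of_irreducible hS (fun g _ => P.permRep_mem_constFun g)
    (Submodule.sum_mem _ fun (n : P.kernel) _ => S.apply_mem_toSubmodule (n : G) hw) ?_ h0)
  refine P.mem_constFun_of_forall hP fun n hn => ?_
  let σ : Representation ℂ P.kernel (FunSpace X) := (permRep G X).comp P.kernel.subtype
  have h := σ.self_norm_apply ⟨n, hn⟩ w
  rw [Representation.norm, LinearMap.sum_apply] at h
  exact h

/-! ### Extension by zero from one part. -/

section ExtendZero

variable (x₀ : X)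

theorem extendZero_apply_coe (u : FunSpace (P.block x₀)) (z : P.block x₀) :
    P.extendZero x₀ u z = u z :=
  Subtype.val_injective.extend_apply _ _ _

theorem extendZero_apply_of_not_rel (u : FunSpace (P.block x₀)) {z : X} (hz : ¬ P.r z x₀) :
    P.extendZero x₀ u z = 0 :=
  Function.extend_apply' _ _ _ fun ⟨z', h⟩ => hz (h ▸ z'.2)

/-- Extension by zero, as a linear map. -/
noncomputable def extendZeroLin : FunSpace (P.block x₀) →ₗ[ℂ] FunSpace X where
  toFun := P.extendZero x₀
  map_add' u u' := by
    ext z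
    by_cases hz : P.r z x₀
    · lift z to P.block x₀ using hz
      simp [extendZero_apply_coe]
    · simp [P.extendZero_apply_of_not_rel x₀ _ hz]
  map_smul' a u := by
    ext z
    by_cases hz : P.r z x₀
    · lift z to P.block x₀ using hz
      simp [extendZero_apply_coe]
    · simp [P.extendZero_apply_of_not_rel x₀ _ hz]

theorem extendZeroLin_apply (u : FunSpace (P.block x₀)) :
    P.extendZeroLin x₀ u = P.extendZero x₀ u := rfl

theorem extendZero_injective : Function.Injective (P.extendZero x₀) := by
  intro u u' h
  ext z
  have := congrArg (fun f : FunSpace X => f z) h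
  simpa [extendZero_apply_coe] using this

theorem inner_extendZero [Fintype X] (u u' : FunSpace (P.block x₀)) :
    inner ℂ (P.extendZero x₀ u) (P.extendZero x₀ u') = inner ℂ u u' := by
  simp only [PiLp.inner_apply]
  symm
  refine Fintype.sum_of_injective Subtype.val Subtype.val_injective _ _ (fun z hz => ?_)
    fun z => ?_
  · rw [P.extendZero_apply_of_not_rel x₀ u fun h => hz ⟨⟨z, h⟩, rfl⟩, inner_zero_left]
  · simp only [extendZero_apply_coe]

theorem extendZero_permRep (t : P.blockStabilizer x₀) (u : FunSpace (P.block x₀)) :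
    P.extendZero x₀ (permRep (P.blockStabilizer x₀) (P.block x₀) t u) =
      permRep G X t (P.extendZero x₀ u) := by
  ext z
  rw [permRep_apply]
  by_cases hz : P.r z x₀
  · lift z to P.block x₀ using hz
    rw [extendZero_apply_coe, permRep_apply]
    exact (P.extendZero_apply_coe x₀ u (t⁻¹ • z)).symm
  · rw [P.extendZero_apply_of_not_rel x₀ _ hz, P.extendZero_apply_of_not_rel x₀]
    intro h
    have h1 := P.smul_rel (t : G) h
    rw [smul_inv_smul] at h1
    exact hz (P.iseqv.trans h1 ((P.mem_blockStabilizer_iff x₀ t).1 t.2))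

theorem stabilizer_le_blockStabilizer : MulAction.stabilizer G x₀ ≤ P.blockStabilizer x₀ := by
  intro k hk
  rw [mem_blockStabilizer_iff, MulAction.mem_stabilizer_iff.1 hk]

theorem isInvariantONB_extendZero [Fintype X] {U : Submodule ℂ (FunSpace (P.block x₀))}
    {ι : Type*} {u : ι → FunSpace (P.block x₀)}
    (hu : IsInvariantONB (P.blockStabilizer x₀) (P.basePoint x₀) U u) :
    IsInvariantONB G x₀ (U.map (P.extendZeroLin x₀)) fun i => P.extendZero x₀ (u i) := by
  classical
  refine ⟨?_, fun f => ?_⟩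
  · have h := hu.1
    rw [orthonormal_iff_ite] at h ⊢
    simpa only [inner_extendZero] using h
  · have hr : Set.range (fun i => P.extendZero x₀ (u i)) =
        P.extendZeroLin x₀ '' Set.range u := by
      rw [← Set.range_comp]; rfl
    rw [hr, Submodule.span_image]
    constructor
    · rintro ⟨u', hu', rfl⟩
      obtain ⟨h1, h2⟩ := (hu.2 u').1 hu'
      refine ⟨⟨u', h1, rfl⟩, fun k hk => ?_⟩
      have := h2 ⟨k, P.stabilizer_le_blockStabilizer x₀ hk⟩ (Subtype.ext hk)
      rw [extendZeroLin_apply, ← P.extendZero_permRep x₀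
        ⟨k, P.stabilizer_le_blockStabilizer x₀ hk⟩, this]
    · rintro ⟨⟨u', h1, rfl⟩, h2⟩
      refine ⟨u', (hu.2 u').2 ⟨h1, fun t ht => P.extendZero_injective x₀ ?_⟩, rfl⟩
      rw [extendZero_permRep]
      exact h2 t (congrArg Subtype.val ht)

/-- An element outside the block stabilizer moves the part to a disjoint one, so the inner product
vanishes exactly where the extended coefficient is zero by definition. -/
theorem isSphericalCoeffs_extendZero [Fintype X] {ι : Type*}
    {u : ι → FunSpace (P.block x₀)} {θ : ι → ι → P.block x₀ → ℂ}
    (hθ : IsSphericalCoeffs (P.blockStabilizer x₀) (P.basePoint x₀) u θ) :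
    IsSphericalCoeffs G x₀ (fun i => P.extendZero x₀ (u i))
      fun i j => Function.extend Subtype.val (θ i j) 0 := by
  intro i j g
  by_cases hg : g ∈ P.blockStabilizer x₀
  · have h1 := hθ i j ⟨g, hg⟩
    rw [← inner_extendZero, extendZero_permRep] at h1
    rw [← h1]
    exact Subtype.val_injective.extend_apply (θ i j) 0 ((⟨g, hg⟩ : P.blockStabilizer x₀) •
      P.basePoint x₀)
  · rw [mem_blockStabilizer_iff] at hg
    refine (Function.extend_apply' _ _ _ ?_).trans ?_
    · rintro ⟨z', h⟩
      exact hg (h ▸ z'.2)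
    rw [Pi.zero_apply, PiLp.inner_apply]
    refine (Finset.sum_eq_zero fun z _ => ?_).symm
    by_cases hz : P.r z x₀
    · rw [permRep_apply, P.extendZero_apply_of_not_rel, inner_zero_left]
      intro h
      have h1 := P.smul_rel g h
      rw [smul_inv_smul] at h1
      exact hg (P.iseqv.trans (P.iseqv.symm h1) hz)
    · rw [P.extendZero_apply_of_not_rel x₀ _ hz, inner_zero_right]

end ExtendZero

end InvariantPartition

/-! ### The action of the crested product on tensors. -/

section Crested

variable {G F X Y : Type*} [Group G] [Group F] [MulAction G X] [MulAction F Y]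
  {P : InvariantPartition G X} {Q : InvariantPartition F Y}

theorem permRep_crestedProduct_apply (c : crestedProduct P Q) (s : FunSpace (X × Y))
    (x : X) (y : Y) : permRep (crestedProduct P Q) (X × Y) c s (x, y) =
      s (c.1.right⁻¹ • x, (c.1.left x)⁻¹ • y) := by
  change s (c.1.right⁻¹ • x, (c.1.left (c.1.right⁻¹⁻¹ • c.1.right⁻¹ • x))⁻¹ • y) = _
  rw [inv_inv, smul_inv_smul]

theorem crestedProduct_smul (c : crestedProduct P Q) (x : X) (y : Y) :
    c • (x, y) = (c.1.right • x, c.1.left (c.1.right • x) • y) := rfl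

theorem crestedProduct_left_eq (c : crestedProduct P Q) {x x' : X} (h : P.r x x') :
    c.1.left x = c.1.left x' := by
  obtain ⟨c, n, -, hP, u, hu⟩ := c
  simp only [hu, hP x x' h]

variable (P Q) in
/-- The elements of `G`, regarded as elements of the crested product. -/
def crestedBase (g : G) : crestedProduct P Q :=
  ⟨⟨1, g⟩, 1, fun _ => Q.kernel.one_mem, fun _ _ _ => rfl, 1, fun _ => by simp⟩

variable (P Q) in
/-- The constant functions with value in `F`, regarded as elements of the crested product. -/
def crestedDiag (u : F) : crestedProduct P Q :=
  ⟨⟨fun _ => u, 1⟩, 1, fun _ => Q.kernel.one_mem, fun _ _ _ => rfl, u, fun _ => by simp⟩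

variable (P) in
open Classical in
/-- The element of the crested product which acts by `n` on the part of `x₁` and trivially on
the other parts. -/
noncomputable def crestedBlock (x₁ : X) (n : Q.kernel) : crestedProduct P Q :=
  ⟨⟨fun x => if P.r x x₁ then n else 1, 1⟩, fun x => if P.r x x₁ then n else 1,
    fun x => by dsimp only; split_ifs; exacts [n.2, Q.kernel.one_mem],
    fun x x' h => if_congr ⟨P.iseqv.trans (P.iseqv.symm h), P.iseqv.trans h⟩ rfl rfl,
    1, fun _ => by simp⟩

theorem permRep_crestedBase_apply (g : G) (s : FunSpace (X × Y)) (x : X) (y : Y) :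
    permRep (crestedProduct P Q) (X × Y) (crestedBase P Q g) s (x, y) = s (g⁻¹ • x, y) := by
  rw [permRep_crestedProduct_apply]
  simp [crestedBase]

theorem permRep_crestedBase_tensorFun (g : G) (v : FunSpace X) (w : FunSpace Y) :
    permRep (crestedProduct P Q) (X × Y) (crestedBase P Q g) (tensorFun v w) =
      tensorFun (permRep G X g v) w := by
  ext ⟨x, y⟩
  rw [permRep_crestedBase_apply]
  rfl

theorem permRep_crestedDiag_tensorFun (u : F) (v : FunSpace X) (w : FunSpace Y) :
    permRep (crestedProduct P Q) (X × Y) (crestedDiag P Q u) (tensorFun v w) =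
      tensorFun v (permRep F Y u w) := by
  ext ⟨x, y⟩
  rw [permRep_crestedProduct_apply]
  simp [crestedDiag]

/-- The crested product acts on `v ⊗ w` through its components at `x₀`. -/
def ActsThrough (P : InvariantPartition G X) (Q : InvariantPartition F Y) (x₀ : X)
    (v : FunSpace X) (w : FunSpace Y) : Prop :=
  ∀ c : crestedProduct P Q, permRep (crestedProduct P Q) (X × Y) c (tensorFun v w) =
    tensorFun (permRep G X c.1.right v) (permRep F Y (c.1.left (c.1.right • x₀)) w)

theorem actsThrough_of_const (x₀ : X) (v : FunSpace X) {w : FunSpace Y} (hw : w ∈ Q.constFun) :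
    ActsThrough P Q x₀ v w := by
  rintro ⟨c, n, hn, -, u, hu⟩
  ext ⟨x, y⟩
  have h : ∀ x, permRep F Y (c.left x) w = permRep F Y u w := fun x => by
    rw [hu, map_mul, Module.End.mul_apply,
      Q.permRep_eq_of_mem_constFun (Q.permRep_mem_constFun u hw) (hn x)]
  rw [permRep_crestedProduct_apply, tensorFun_apply, tensorFun_apply, h, ← h x]
  rfl

theorem actsThrough_of_support {x₀ : X} {v : FunSpace X} (hv : ∀ x, ¬ P.r x x₀ → v x = 0)
    (w : FunSpace Y) : ActsThrough P Q x₀ v w := by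
  intro c
  ext ⟨x, y⟩
  rw [permRep_crestedProduct_apply, tensorFun_apply, tensorFun_apply, permRep_apply,
    permRep_apply]
  by_cases hx : P.r (c.1.right⁻¹ • x) x₀
  · have h1 := P.smul_rel c.1.right hx
    rw [smul_inv_smul] at h1
    rw [crestedProduct_left_eq c h1]
  · rw [hv _ hx, zero_mul, zero_mul]

theorem map_mem_of_mem_tensorSub {E : Type*} [AddCommGroup E] [Module ℂ E]
    (T : FunSpace (X × Y) →ₗ[ℂ] E)
    {M : Submodule ℂ E} {V : Submodule ℂ (FunSpace X)}
    {W : Submodule ℂ (FunSpace Y)} (h : ∀ v ∈ V, ∀ w ∈ W, T (tensorFun v w) ∈ M)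
    {s : FunSpace (X × Y)} (hs : s ∈ tensorSub V W) : T s ∈ M := by
  refine Submodule.span_le.2 (?_ : _ ⊆ (M.comap T : Set (FunSpace (X × Y)))) hs
  rintro _ ⟨v, hv, w, hw, rfl⟩
  exact h v hv w hw

/-- The family `g` leaves room for two uses: all of `G` acting on an irreducible `V`, or only the
stabilizer of a part acting on functions supported there. -/
theorem tensorSub_le_of_invariant {ι : Type*} (g : ι → G) {V : Submodule ℂ (FunSpace X)}
    (hV : ∀ x₁, ∀ v' ∈ V, ∃ c : ι →₀ ℂ, ∀ v ∈ V,
      (c.sum fun i a => a • permRep G X (g i) v) = v x₁ • v')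
    (W : Subrepresentation (permRep F Y)) (hW : W.toRepresentation.IsIrreducible)
    {S : Submodule ℂ (FunSpace (X × Y))}
    (hS : ∀ c : crestedProduct P Q, ∀ s ∈ S, permRep (crestedProduct P Q) (X × Y) c s ∈ S)
    {s : FunSpace (X × Y)} (hs : s ∈ tensorSub V W.toSubmodule) (hsS : s ∈ S) (hs0 : s ≠ 0) :
    tensorSub V W.toSubmodule ≤ S := by
  refine tensorSub_le_of_mem (fun i => permRep G X (g i))
    (fun i => permRep (crestedProduct P Q) (X × Y) (crestedBase P Q (g i)))
    (fun i v _ w _ => permRep_crestedBase_tensorFun _ v w) (fun i => hS _) hV ?_ hs hsS hs0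
  intro v _ w hw hw0 hwS w' hw'
  refine W.le_of_irreducible hW (M := S.comap (tensorBilin X Y v)) (fun u w hw => ?_)
    hw hwS hw0 hw'
  rw [Submodule.mem_comap, tensorBilin_apply, ← permRep_crestedDiag_tensorFun (P := P) (Q := Q)]
  exact hS _ _ hw

/-- The space `M` may exceed `V ⊗ W`, and `V` need only be invariant under the stabilizer of `x₀`:
for induced representations `V` is `U` extended by zero, and `hfix` confines the invariant vectors
of `M` to `V ⊗ W`. -/
theorem isInvariantONB_tensorFun [Finite G] [Finite F] [Fintype X] [Fintype Y] {x₀ : X} {y₀ : Y}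
    {V : Submodule ℂ (FunSpace X)} {W : Submodule ℂ (FunSpace Y)}
    {M : Submodule ℂ (FunSpace (X × Y))} {ι κ : Type*} {v : ι → FunSpace X}
    {w : κ → FunSpace Y} (hv : IsInvariantONB G x₀ V v) (hw : IsInvariantONB F y₀ W w)
    (hVK : ∀ k ∈ MulAction.stabilizer G x₀, ∀ v ∈ V, permRep G X k v ∈ V)
    (hWH : ∀ h, ∀ w ∈ W, permRep F Y h w ∈ W)
    (hact : ∀ v ∈ V, ∀ w ∈ W, ActsThrough P Q x₀ v w) (hM : tensorSub V W ≤ M)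
    (hfix : ∀ s ∈ M, (∀ c ∈ MulAction.stabilizer (crestedProduct P Q) (x₀, y₀),
      permRep (crestedProduct P Q) (X × Y) c s = s) → s ∈ tensorSub V W) :
    IsInvariantONB (crestedProduct P Q) (x₀, y₀) M
      fun p : ι × κ => tensorFun (v p.1) (w p.2) := by
  refine ⟨hv.1.tensorFun hw.1, fun s => ?_⟩
  rw [span_range_tensorFun]
  constructor
  · refine fun hs => ⟨hM (map_mem_of_mem_tensorSub LinearMap.id
      (fun v' hv' w' hw' => tensorFun_mem ((hv.2 v').1 hv').1 ((hw.2 w').1 hw').1) hs),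
      fun c hc => ?_⟩
    refine LinearMap.eqOn_span (R := ℂ) (g := LinearMap.id) ?_ hs
    rintro _ ⟨v', hv', w', hw', rfl⟩
    obtain ⟨hv1, hv2⟩ := (hv.2 v').1 hv'
    obtain ⟨hw1, hw2⟩ := (hw.2 w').1 hw'
    rw [MulAction.mem_stabilizer_iff, crestedProduct_smul, Prod.mk.injEq] at hc
    rw [hact v' hv1 w' hw1 c, hv2 _ hc.1, hw2 _ hc.2]
    rfl
  · rintro ⟨hs, hinv⟩
    -- Of the stabilizer of `(x₀, y₀)`, only the products of an element of `K` with a constant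
    -- function valued in `H` are needed here.
    refine mem_tensorSub_of_forall_fixed (K := MulAction.stabilizer G x₀)
      (H := MulAction.stabilizer F y₀)
      ((permRep G X).comp (Subgroup.subtype _)) ((permRep F Y).comp (Subgroup.subtype _))
      (fun k h => permRep (crestedProduct P Q) (X × Y) (crestedBase P Q k * crestedDiag P Q h))
      (fun k h v' _ w' _ => ?_) (fun k => hVK k k.2) (fun h => hWH h)
      (fun v' hv' h => (hv.2 v').2 ⟨hv', fun k hk => h ⟨k, hk⟩⟩)
      (fun w' hw' h => (hw.2 w').2 ⟨hw', fun k hk => h ⟨k, hk⟩⟩) (hfix s hs hinv)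
      fun k h => hinv _ (Subgroup.mul_mem _ ?_ ?_)
    · rw [map_mul, Module.End.mul_apply, permRep_crestedDiag_tensorFun,
        permRep_crestedBase_tensorFun]
      rfl
    · rw [MulAction.mem_stabilizer_iff, crestedProduct_smul]
      exact Prod.ext k.2 (one_smul F y₀)
    · rw [MulAction.mem_stabilizer_iff, crestedProduct_smul]
      exact Prod.ext (one_smul G x₀) h.2

theorem isSphericalCoeffs_tensorFun [Fintype X] [Fintype Y] {x₀ : X} {y₀ : Y} {ι κ : Type*}
    {v : ι → FunSpace X} {w : κ → FunSpace Y} {φ : ι → ι → X → ℂ} {ψ : κ → κ → Y → ℂ}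
    (hφ : IsSphericalCoeffs G x₀ v φ) (hψ : IsSphericalCoeffs F y₀ w ψ)
    (hact : ∀ i j, ActsThrough P Q x₀ (v i) (w j)) :
    IsSphericalCoeffs (crestedProduct P Q) (x₀, y₀)
      (fun p : ι × κ => tensorFun (v p.1) (w p.2))
      fun p q z => φ p.1 q.1 z.1 * ψ p.2 q.2 z.2 := by
  intro p q c
  rw [hact, inner_tensorFun, crestedProduct_smul, ← hφ, ← hψ]

open Classical in
/-- The restriction of a function to the union of the sets `{x} × Y`, `x` in the part of `x₁`,
extended by zero. -/
noncomputable def blockRestrict (P : InvariantPartition G X) (x₁ : X) :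
    Module.End ℂ (FunSpace (X × Y)) where
  toFun s := WithLp.toLp 2 fun z => if P.r z.1 x₁ then s z else 0
  map_add' s s' := by
    ext z
    by_cases h : P.r z.1 x₁ <;> simp [h]
  map_smul' a s := by
    ext z
    by_cases h : P.r z.1 x₁ <;> simp [h]

theorem blockRestrict_apply_of_rel {x x₁ : X} (h : P.r x x₁) (s : FunSpace (X × Y)) (y : Y) :
    blockRestrict P x₁ s (x, y) = s (x, y) := if_pos h

theorem blockRestrict_apply_of_not_rel {x x₁ : X} (h : ¬ P.r x x₁) (s : FunSpace (X × Y))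
    (y : Y) : blockRestrict P x₁ s (x, y) = 0 := if_neg h

/-- Over the part of `x₁` the sum is the vanishing sum over `N`; elsewhere every term equals `s`. -/
theorem sum_permRep_crestedBlock [Fintype Q.kernel] (x₁ : X) {s : FunSpace (X × Y)}
    (hs : ∀ x, ∑ n : Q.kernel, permRep F Y n (slice x s) = 0) :
    ∑ n : Q.kernel, permRep (crestedProduct P Q) (X × Y) (crestedBlock P x₁ n) s =
      (Fintype.card Q.kernel : ℂ) • (s - blockRestrict P x₁ s) := by
  ext ⟨x, y⟩
  rw [WithLp.ofLp_sum, Finset.sum_apply]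
  simp only [permRep_crestedProduct_apply, PiLp.smul_apply, PiLp.sub_apply]
  by_cases h : P.r x x₁
  · rw [blockRestrict_apply_of_rel h, sub_self, smul_zero]
    have h1 := congrArg (fun f : FunSpace Y => f y) (hs x)
    rw [WithLp.ofLp_sum, Finset.sum_apply] at h1
    simpa [crestedBlock, h] using h1
  · rw [blockRestrict_apply_of_not_rel h, sub_zero]
    simp [crestedBlock, h]

end Crested

/-! ### Irreducibility and invariant vectors in the two cases. -/

section CrestedIrreducible

variable {G F X Y : Type*} [Group G] [Group F] [MulAction G X] [MulAction F Y]
  {P : InvariantPartition G X} {Q : InvariantPartition F Y}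

theorem tensorSub_mono {V V' : Submodule ℂ (FunSpace X)} {W W' : Submodule ℂ (FunSpace Y)}
    (hV : V ≤ V') (hW : W ≤ W') : tensorSub V W ≤ tensorSub V' W' :=
  fun _ hs => map_mem_of_mem_tensorSub LinearMap.id
    (fun _ hv _ hw => tensorFun_mem (hV hv) (hW hw)) hs

theorem tensorSub_ne_bot {V : Submodule ℂ (FunSpace X)} {W : Submodule ℂ (FunSpace Y)}
    (hV : ∃ v ∈ V, v ≠ 0) (hW : ∃ w ∈ W, w ≠ 0) : tensorSub V W ≠ ⊥ := by
  obtain ⟨v, hv, hv0⟩ := hV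
  obtain ⟨w, hw, hw0⟩ := hW
  intro h
  have h1 := tensorFun_mem hv hw
  rw [h, Submodule.mem_bot] at h1
  obtain ⟨x, hx⟩ : ∃ x, v x ≠ 0 := by
    by_contra! h; exact hv0 (by ext x; exact h x)
  obtain ⟨y, hy⟩ : ∃ y, w y ≠ 0 := by
    by_contra! h; exact hw0 (by ext y; exact h y)
  exact mul_ne_zero hx hy (congrArg (fun f : FunSpace (X × Y) => f (x, y)) h1)

/-- Evaluation at a point, as a linear form. -/
noncomputable def evalAt (x : X) : FunSpace X →ₗ[ℂ] ℂ where
  toFun f := f x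
  map_add' _ _ := rfl
  map_smul' _ _ := rfl

theorem isIrreducibleSub_tensorSub_of_const [Finite X] (x₀ : X)
    (V : Subrepresentation (permRep G X)) (W : Subrepresentation (permRep F Y))
    (hV : V.toRepresentation.IsIrreducible) (hW : W.toRepresentation.IsIrreducible)
    (hconst : W.toSubmodule ≤ Q.constFun) :
    IsIrreducibleSub (permRep (crestedProduct P Q) (X × Y))
      (tensorSub V.toSubmodule W.toSubmodule) := by
  have := Fintype.ofFinite X
  refine isIrreducibleSub_of_forall_le
    (fun c s hs => map_mem_of_mem_tensorSub _ (fun v hv w hw => ?_) hs)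
    (tensorSub_ne_bot (V.exists_ne_zero hV) (W.exists_ne_zero hW)) fun S hle hS hne => ?_
  · rw [actsThrough_of_const x₀ v (hconst hw)]
    exact tensorFun_mem (V.apply_mem_toSubmodule _ hv) (W.apply_mem_toSubmodule _ hw)
  · obtain ⟨s, hs, hs0⟩ := Submodule.exists_mem_ne_zero_of_ne_bot hne
    exact tensorSub_le_of_invariant id
      (fun x₁ v' hv' => V.exists_sum_smul_eq hV (evalAt x₁) hv') W hW hS (hle hs) hs hs0

namespace InvariantPartition

theorem exists_sum_smul_extendZero [Finite X] (x₀ : X)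
    (U : Subrepresentation (permRep (P.blockStabilizer x₀) (P.block x₀)))
    (hU : U.toRepresentation.IsIrreducible) (x₁ : X) {v' : FunSpace X}
    (hv' : v' ∈ U.toSubmodule.map (P.extendZeroLin x₀)) :
    ∃ c : P.blockStabilizer x₀ →₀ ℂ, ∀ v ∈ U.toSubmodule.map (P.extendZeroLin x₀),
      (c.sum fun t a => a • permRep G X (t : G) v) = v x₁ • v' := by
  obtain ⟨u', hu', rfl⟩ := hv'
  obtain ⟨c, hc⟩ := U.exists_sum_smul_eq hU ((evalAt x₁).comp (P.extendZeroLin x₀)) hu'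
  refine ⟨c, ?_⟩
  rintro _ ⟨u, hu, rfl⟩
  have h := congrArg (P.extendZeroLin x₀) (hc u hu)
  rw [map_smul, Finsupp.sum, map_sum] at h
  simp only [map_smul, extendZeroLin_apply, extendZero_permRep] at h
  exact h

theorem map_extendZeroLin_le_induced (x₀ : X) (U : Submodule ℂ (FunSpace (P.block x₀))) :
    U.map (P.extendZeroLin x₀) ≤ P.induced x₀ U := by
  rintro _ ⟨u, hu, rfl⟩
  exact Submodule.subset_span ⟨1, u, hu, by rw [map_one]; rfl⟩

theorem map_mem_of_mem_tensorSub_induced (x₀ : X) {U : Submodule ℂ (FunSpace (P.block x₀))}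
    {W : Submodule ℂ (FunSpace Y)} (A : Module.End ℂ (FunSpace (X × Y)))
    {S : Submodule ℂ (FunSpace (X × Y))}
    (h : ∀ g : G, ∀ u ∈ U, ∀ w ∈ W,
      A (tensorFun (permRep G X g (P.extendZero x₀ u)) w) ∈ S)
    {s : FunSpace (X × Y)} (hs : s ∈ tensorSub (P.induced x₀ U) W) : A s ∈ S := by
  refine map_mem_of_mem_tensorSub A (fun v hv w hw => ?_) hs
  refine Submodule.span_le.2
    (?_ : _ ⊆ (S.comap (A.comp ((tensorBilin X Y).flip w)) : Set (FunSpace X))) hv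
  rintro _ ⟨g, u, hu, rfl⟩
  exact h g u hu w hw

theorem permRep_extendZero_apply_of_not_rel (x₀ : X) (g : G) (u : FunSpace (P.block x₀))
    {x : X} (hx : ¬ P.r x (g • x₀)) : permRep G X g (P.extendZero x₀ u) x = 0 := by
  refine P.extendZero_apply_of_not_rel x₀ u fun h => hx ?_
  have h1 := P.smul_rel g h
  rwa [smul_inv_smul] at h1

theorem permRep_mem_map_extendZeroLin (x₀ : X)
    (U : Subrepresentation (permRep (P.blockStabilizer x₀) (P.block x₀)))
    (t : P.blockStabilizer x₀) {v : FunSpace X}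
    (hv : v ∈ U.toSubmodule.map (P.extendZeroLin x₀)) :
    permRep G X t v ∈ U.toSubmodule.map (P.extendZeroLin x₀) := by
  obtain ⟨u, hu, rfl⟩ := hv
  exact ⟨_, U.apply_mem_toSubmodule t hu, P.extendZero_permRep x₀ t u⟩

/-- A translate `g ũ` lives on a single part: restriction to the part of `x₀` keeps it, still in the
extension of `U`, if `g` stabilizes that part, and kills it otherwise. -/
theorem blockRestrict_mem (x₀ : X)
    (U : Subrepresentation (permRep (P.blockStabilizer x₀) (P.block x₀)))
    {W : Submodule ℂ (FunSpace Y)} {s : FunSpace (X × Y)}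
    (hs : s ∈ tensorSub (P.induced x₀ U.toSubmodule) W) :
    blockRestrict P x₀ s ∈ tensorSub (U.toSubmodule.map (P.extendZeroLin x₀)) W := by
  refine P.map_mem_of_mem_tensorSub_induced x₀ _ (fun g u hu w hw => ?_) hs
  by_cases hg : P.r (g • x₀) x₀
  · have h : blockRestrict P x₀ (tensorFun (permRep G X g (P.extendZero x₀ u)) w) =
        tensorFun (permRep G X g (P.extendZero x₀ u)) w := by
      ext ⟨x, y⟩
      by_cases hx : P.r x x₀
      · rw [blockRestrict_apply_of_rel hx]
      · rw [blockRestrict_apply_of_not_rel hx, tensorFun_apply,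
          P.permRep_extendZero_apply_of_not_rel x₀ g u fun h => hx (P.iseqv.trans h hg), zero_mul]
    rw [h]
    exact tensorFun_mem (P.permRep_mem_map_extendZeroLin x₀ U
      ⟨g, (P.mem_blockStabilizer_iff x₀ g).2 hg⟩ ⟨u, hu, rfl⟩) hw
  · convert Submodule.zero_mem _
    ext ⟨x, y⟩
    by_cases hx : P.r x x₀
    · rw [blockRestrict_apply_of_rel hx, tensorFun_apply,
        P.permRep_extendZero_apply_of_not_rel x₀ g u fun h =>
          hg (P.iseqv.trans (P.iseqv.symm h) hx), zero_mul]
      rfl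
    · rw [blockRestrict_apply_of_not_rel hx]
      rfl

end InvariantPartition

theorem blockRestrict_eq [Fintype Q.kernel] (x₁ : X) {s : FunSpace (X × Y)}
    (hs : ∀ x, ∑ n : Q.kernel, permRep F Y n (slice x s) = 0) :
    blockRestrict P x₁ s = s - (Fintype.card Q.kernel : ℂ)⁻¹ •
      ∑ n : Q.kernel, permRep (crestedProduct P Q) (X × Y) (crestedBlock P x₁ n) s := by
  rw [sum_permRep_crestedBlock x₁ hs, inv_smul_smul₀ (by simp [Fintype.card_ne_zero]),
    sub_sub_cancel]

theorem isIrreducibleSub_tensorSub_induced [Finite F] [Finite X]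
    [MulAction.IsPretransitive G X] (x₀ : X)
    (hQ : ∀ y y', Q.r y y' → ∃ n ∈ Q.kernel, n • y = y')
    (U : Subrepresentation (permRep (P.blockStabilizer x₀) (P.block x₀)))
    (W : Subrepresentation (permRep F Y))
    (hU : U.toRepresentation.IsIrreducible) (hW : W.toRepresentation.IsIrreducible)
    (hconst : ¬ W.toSubmodule ≤ Q.constFun) :
    IsIrreducibleSub (permRep (crestedProduct P Q) (X × Y))
      (tensorSub (P.induced x₀ U.toSubmodule) W.toSubmodule) := by
  have := Fintype.ofFinite Q.kernel
  refine isIrreducibleSub_of_forall_le (fun c s hs => ?_) ?_ fun S hle hS hne => ?_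
  · refine P.map_mem_of_mem_tensorSub_induced x₀ _ (fun g u hu w hw => ?_) hs
    -- The translate `g ũ` is supported on the part of `g • x₀`, so that point replaces `x₀` as base
    -- point.
    rw [actsThrough_of_support (x₀ := g • x₀) fun x =>
      P.permRep_extendZero_apply_of_not_rel x₀ g u, ← Module.End.mul_apply, ← map_mul]
    exact tensorFun_mem (Submodule.subset_span ⟨_, u, hu, rfl⟩) (W.apply_mem_toSubmodule _ hw)
  · refine tensorSub_ne_bot ?_ (W.exists_ne_zero hW)
    obtain ⟨u, hu, hu0⟩ := U.exists_ne_zero hU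
    refine ⟨P.extendZero x₀ u, P.map_extendZeroLin_le_induced x₀ _ ⟨u, hu, rfl⟩, fun h => hu0 ?_⟩
    exact P.extendZero_injective x₀ (h.trans (map_zero (P.extendZeroLin x₀)).symm)
  · obtain ⟨s, hs, hs0⟩ := Submodule.exists_mem_ne_zero_of_ne_bot hne
    obtain ⟨⟨x₁, y₁⟩, h1⟩ : ∃ z, s z ≠ 0 := by
      by_contra! h
      exact hs0 (by ext z; exact h z)
    obtain ⟨g, rfl⟩ := MulAction.exists_smul_eq G x₀ x₁
    -- Translating by `g⁻¹` brings a point where `s` does not vanish over `x₀`, so restriction to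
    -- the part of `x₀` stays nonzero.
    let s' := permRep (crestedProduct P Q) (X × Y) (crestedBase P Q g⁻¹) s
    have hs' : s' ∈ S := hS _ s hs
    have hsum : ∀ x, ∑ n : Q.kernel, permRep F Y n (slice x s') = 0 := fun x =>
      Q.sum_kernel_eq_zero hQ W hW hconst (slice_mem (hle hs') x)
    have hr : blockRestrict P x₀ s' ∈ S := by
      rw [blockRestrict_eq x₀ hsum]
      exact S.sub_mem hs' (S.smul_mem _ (S.sum_mem fun n _ => hS _ _ hs'))
    have hr0 : blockRestrict P x₀ s' ≠ 0 := by
      intro h0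
      have h2 := congrArg (fun f : FunSpace (X × Y) => f (x₀, y₁)) h0
      dsimp only [s'] at h2
      rw [blockRestrict_apply_of_rel (P.iseqv.refl x₀), permRep_crestedBase_apply, inv_inv] at h2
      exact h1 h2
    have hU' := tensorSub_le_of_invariant (Subtype.val : P.blockStabilizer x₀ → G)
      (fun x₁ v' hv' => P.exists_sum_smul_extendZero x₀ U hU x₁ hv') W hW hS
      (P.blockRestrict_mem x₀ U (hle hs')) hr hr0
    refine fun t ht => P.map_mem_of_mem_tensorSub_induced x₀ LinearMap.id
      (fun g u hu w hw => ?_) ht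
    rw [LinearMap.id_apply, ← permRep_crestedBase_tensorFun (P := P) (Q := Q)]
    exact hS _ _ (hU' (tensorFun_mem ⟨u, hu, rfl⟩ hw))

/-- Copies of `N` acting on a part not containing `x₀` fix `(x₀, y₀)`, hence fix `s`. Their average
also annihilates `s` over that part, so `s` vanishes there. -/
theorem mem_tensorSub_of_forall_stabilizer [Finite F] (x₀ : X) (y₀ : Y)
    (hQ : ∀ y y', Q.r y y' → ∃ n ∈ Q.kernel, n • y = y')
    (U : Subrepresentation (permRep (P.blockStabilizer x₀) (P.block x₀)))
    (W : Subrepresentation (permRep F Y)) (hW : W.toRepresentation.IsIrreducible)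
    (hconst : ¬ W.toSubmodule ≤ Q.constFun) {s : FunSpace (X × Y)}
    (hs : s ∈ tensorSub (P.induced x₀ U.toSubmodule) W.toSubmodule)
    (hfix : ∀ c ∈ MulAction.stabilizer (crestedProduct P Q) (x₀, y₀),
      permRep (crestedProduct P Q) (X × Y) c s = s) :
    s ∈ tensorSub (U.toSubmodule.map (P.extendZeroLin x₀)) W.toSubmodule := by
  have := Fintype.ofFinite Q.kernel
  have hsum : ∀ x, ∑ n : Q.kernel, permRep F Y n (slice x s) = 0 := fun x =>
    Q.sum_kernel_eq_zero hQ W hW hconst (slice_mem hs x)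
  have h : blockRestrict P x₀ s = s := by
    ext ⟨x, y⟩
    by_cases hx : P.r x x₀
    · rw [blockRestrict_apply_of_rel hx]
    · rw [blockRestrict_apply_of_not_rel hx]
      have h1 : ∀ n : Q.kernel,
          permRep (crestedProduct P Q) (X × Y) (crestedBlock P x n) s = s := by
        refine fun n => hfix _ ?_
        have hx' : ¬ P.r x₀ x := fun h => hx (P.iseqv.symm h)
        rw [MulAction.mem_stabilizer_iff, crestedProduct_smul]
        simp [crestedBlock, hx']
      have h2 := blockRestrict_eq (P := P) x hsum
      simp only [h1, Finset.sum_const, Finset.card_univ, ← Nat.cast_smul_eq_nsmul ℂ] at h2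
      rw [inv_smul_smul₀ (by simp [Fintype.card_ne_zero]), sub_self] at h2
      have h3 := congrArg (fun f : FunSpace (X × Y) => f (x, y)) h2
      dsimp only at h3
      rw [blockRestrict_apply_of_rel (P.iseqv.refl x)] at h3
      exact h3.symm
  rw [← h]
  exact P.blockRestrict_mem x₀ U hs

end CrestedIrreducible
-- Assembly of the two cases.
theorem mainTheorem9 {G F X Y : Type*} [Group G] [Finite G] [Group F] [Finite F]
    [Fintype X] [Fintype Y] [MulAction G X] [MulAction F Y]
    [MulAction.IsPretransitive G X] [MulAction.IsPretransitive F Y] (x₀ : X) (y₀ : Y)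
    (P : InvariantPartition G X) (Q : InvariantPartition F Y)
    (hQ : ∀ y y', Q.r y y' → ∃ n ∈ Q.kernel, n • y = y')
    {Ω Δ Γ : Type*} (a : Ω → ℕ) (b : Δ → ℕ) (c : Γ → ℕ)
    (V : (ω : Ω) → Fin (a ω) → Subrepresentation (permRep G X))
    (W : (δ : Δ) → Fin (b δ) → Subrepresentation (permRep F Y))
    (U : (γ : Γ) → Fin (c γ) → Subrepresentation (permRep (P.blockStabilizer x₀) (P.block x₀)))
    (hV : IsIsotypicDecomposition (permRep G X) a V)
    (hW : IsIsotypicDecomposition (permRep F Y) b W)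
    (hU : IsIsotypicDecomposition (permRep (P.blockStabilizer x₀) (P.block x₀)) c U) :
    (∀ (ω : Ω) (k : Fin (a ω)) (δ : Δ) (l : Fin (b δ)), δ ∈ Q.constIndices W →
      IsIrreducibleSub (permRep (crestedProduct P Q) (X × Y))
        (tensorSub (V ω k).toSubmodule (W δ l).toSubmodule) ∧
      ∀ (v : Fin (a ω) → FunSpace X) (w : Fin (b δ) → FunSpace Y)
        (φ : Fin (a ω) → Fin (a ω) → X → ℂ) (ψ : Fin (b δ) → Fin (b δ) → Y → ℂ),
        IsInvariantONB G x₀ (V ω k).toSubmodule v → IsSphericalCoeffs G x₀ v φ →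
        IsInvariantONB F y₀ (W δ l).toSubmodule w → IsSphericalCoeffs F y₀ w ψ →
        IsInvariantONB (crestedProduct P Q) (x₀, y₀)
          (tensorSub (V ω k).toSubmodule (W δ l).toSubmodule)
          (fun p : Fin (a ω) × Fin (b δ) => tensorFun (v p.1) (w p.2)) ∧
        IsSphericalCoeffs (crestedProduct P Q) (x₀, y₀)
          (fun p : Fin (a ω) × Fin (b δ) => tensorFun (v p.1) (w p.2))
          (fun p q z => φ p.1 q.1 z.1 * ψ p.2 q.2 z.2)) ∧
    (∀ (γ : Γ) (k : Fin (c γ)) (δ : Δ) (l : Fin (b δ)), δ ∉ Q.constIndices W →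
      IsIrreducibleSub (permRep (crestedProduct P Q) (X × Y))
        (tensorSub (P.induced x₀ (U γ k).toSubmodule) (W δ l).toSubmodule) ∧
      ∀ (u : Fin (c γ) → FunSpace (P.block x₀)) (w : Fin (b δ) → FunSpace Y)
        (θ : Fin (c γ) → Fin (c γ) → P.block x₀ → ℂ) (ψ : Fin (b δ) → Fin (b δ) → Y → ℂ),
        IsInvariantONB (P.blockStabilizer x₀) (P.basePoint x₀) (U γ k).toSubmodule u →
        IsSphericalCoeffs (P.blockStabilizer x₀) (P.basePoint x₀) u θ →
        IsInvariantONB F y₀ (W δ l).toSubmodule w → IsSphericalCoeffs F y₀ w ψ →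
        IsInvariantONB (crestedProduct P Q) (x₀, y₀)
          (tensorSub (P.induced x₀ (U γ k).toSubmodule) (W δ l).toSubmodule)
          (fun p : Fin (c γ) × Fin (b δ) => tensorFun (P.extendZero x₀ (u p.1)) (w p.2)) ∧
        IsSphericalCoeffs (crestedProduct P Q) (x₀, y₀)
          (fun p : Fin (c γ) × Fin (b δ) => tensorFun (P.extendZero x₀ (u p.1)) (w p.2))
          (fun p q z => Function.extend Subtype.val (θ p.1 q.1) 0 z.1 * ψ p.2 q.2 z.2)) := by
  refine ⟨fun ω k δ l hδ => ?_, fun γ k δ l hδ => ?_⟩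
  -- The condition on the whole isotypic component becomes one on the chosen copy; beyond this, only
  -- irreducibility of the summands is used.
  · rw [Q.mem_constIndices_iff hQ hW l] at hδ
    refine ⟨isIrreducibleSub_tensorSub_of_const x₀ _ _ (hV.irreducible ω k)
      (hW.irreducible δ l) hδ, fun v w φ ψ hv hφ hw hψ => ⟨?_, ?_⟩⟩
    · exact isInvariantONB_tensorFun hv hw (fun g _ _ hv => (V ω k).apply_mem_toSubmodule g hv)
        (fun h _ hw => (W δ l).apply_mem_toSubmodule h hw)
        (fun v _ _ hw => actsThrough_of_const x₀ v (hδ hw)) le_rfl fun _ hs _ => hs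
    · exact isSphericalCoeffs_tensorFun hφ hψ fun i j => actsThrough_of_const x₀ (v i)
        (hδ ((hw.2 _).1 (Submodule.subset_span ⟨j, rfl⟩)).1)
  · rw [Q.mem_constIndices_iff hQ hW l] at hδ
    refine ⟨isIrreducibleSub_tensorSub_induced x₀ hQ _ _ (hU.irreducible γ k)
      (hW.irreducible δ l) hδ, fun u w θ ψ hu hθ hw hψ => ⟨?_, ?_⟩⟩
    · have hu' := P.isInvariantONB_extendZero x₀ hu
      refine isInvariantONB_tensorFun (v := fun i => P.extendZero x₀ (u i))
        (V := (U γ k).toSubmodule.map (P.extendZeroLin x₀)) (W := (W δ l).toSubmodule) hu' hw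
        (fun g hg _ hv => P.permRep_mem_map_extendZeroLin x₀ (U γ k)
          ⟨g, P.stabilizer_le_blockStabilizer x₀ hg⟩ hv)
        (fun h _ hw => (W δ l).apply_mem_toSubmodule h hw) ?_
        (tensorSub_mono (P.map_extendZeroLin_le_induced x₀ _) le_rfl)
        fun s hs hfix => mem_tensorSub_of_forall_stabilizer x₀ y₀ hQ _ _ (hW.irreducible δ l) hδ
          hs hfix
      rintro _ ⟨u', _, rfl⟩ w' _
      exact actsThrough_of_support (fun _ => P.extendZero_apply_of_not_rel x₀ u') w'
    · exact isSphericalCoeffs_tensorFun (P.isSphericalCoeffs_extendZero x₀ hθ) hψ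
        fun i j => actsThrough_of_support
          (fun _ => P.extendZero_apply_of_not_rel x₀ (u i)) (w j)
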